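/- A mixed graph $G$ is a finite nonempty vertex set $V(G)$ together with undirected and directed edges such that there are no loops and any two vertices are joined by at most one edge (undirected or directed). For a vertex $u$ let $d^*(u)$, $d^+(u)$, $d^-(u)$ be the numbers of undirected edges at $u$, of directed edges leaving $u$ and of directed edges entering $u$, and let $\Delta^* = \max_{v} d^*(v)$. An orientable path from $x$ to $y$ is a sequence of distinct vertices $x = x_0, x_1, \dots, x_k = y$ such that, for each $i<k$, either $x_i x_{i+1}$ is an undirected edge or there is a directed edge from $x_i$ to $x_{i+1}$; its length is $k$. $G$ is connected if for all $x, y$ there is an orientable path from $x$ to $y$. A bridge is an undirected edge $e$ such that $G-e$ is not connected, and $G$ is bridgeless if it is connected and has no bridge. The distance from $x$ to $y$ is the least length of an orientable path from $x$ to $y$, and the diameter is the maximum distance over all ordered pairs of vertices. A strong orientation of $G$ is a connected directed graph obtained by assigning a direction to each undirected edge of $G$ (and keeping the directed edges); the oriented diameter $\overrightarrow{\mathrm{diam}}(G)$ is the minimum diameter of a strong orientation of $G$. **Statement.** Let $G$ be a bridgeless mixed graph with $n$ vertices and maximum undirected degree $\Delta^*$. Then $G$ has a strong orientation, and \[ \overrightarrow{\mathrm{diam}}(G)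 \le \begin{cases} n - \Delta^* + 3, & \text{if } G \text{ is undirected (has no directed edge)},\\ & \text{or if } G \text{ has a vertex } u \text{ with } d^*(u)=\Delta^* \text{ and } d^+(u)+d^-(u)\ge 2,\\ & \text{or if } G \text{ has a vertex } u \text{ with } d^*(u)=\Delta^*=5 \text{ and } d^+(u)+d^-(u)=1;\\ n-\Delta^*+4, & \text{otherwise.} \end{cases} \] -/

import Mathlib

/-- A mixed graph on the vertex set `V` whose underlying graph is simple: there are no loops, and
any two vertices are joined by at most one edge, which is either undirected or directed. -/
structure MixedGraph (V : Type*) where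
  /-- `Edge x y`: there is an undirected edge joining `x` and `y`. -/
  Edge : V → V → Prop
  /-- `Arc x y`: there is a directed edge from `x` to `y`. -/
  Arc : V → V → Prop
  edge_symm : ∀ x y, Edge x y → Edge y x
  edge_irrefl : ∀ x, ¬ Edge x x
  arc_irrefl : ∀ x, ¬ Arc x x
  arc_asymm : ∀ x y, Arc x y → ¬ Arc y x
  not_arc_of_edge : ∀ x y, Edge x y → ¬ Arc x y

namespace MixedGraph

variable {V : Type*}

/-- One can go from `x` to `y` along an undirected edge or along a directed edge from `x`. -/
def Step (G : MixedGraph V) (x y : V) : Prop :=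
  G.Edge x y ∨ G.Arc x y

/-- There is an orientable path from `x` to `y` with exactly `k` edges: a sequence of `k + 1`
distinct vertices from `x` to `y`, each followed by the next along an undirected edge or along a
directed edge in the forward direction. -/
def HasPath (G : MixedGraph V) (x y : V) (k : ℕ) : Prop :=
  ∃ p : Fin (k + 1) → V, Function.Injective p ∧ p 0 = x ∧ p (Fin.last k) = y ∧
    ∀ i : Fin k, G.Step (p i.castSucc) (p i.succ)

/-- A mixed graph is connected if for any two vertices `x`, `y` there are orientable paths from
`x` to `y` and from `y` to `x` (the quantification is over all ordered pairs). -/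
def Connected (G : MixedGraph V) : Prop :=
  ∀ x y, ∃ k, G.HasPath x y k

/-- The mixed graph `G - e`, where `e` is the undirected edge `xy`. -/
def deleteEdge (G : MixedGraph V) (x y : V) : MixedGraph V where
  Edge a b := G.Edge a b ∧ s(a, b) ≠ s(x, y)
  Arc := G.Arc
  edge_symm a b h := ⟨G.edge_symm a b h.1, by rw [Sym2.eq_swap]; exact h.2⟩
  edge_irrefl a h := G.edge_irrefl a h.1
  arc_irrefl := G.arc_irrefl
  arc_asymm := G.arc_asymm
  not_arc_of_edge a b h := G.not_arc_of_edge a b h.1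

/-- A bridge is an undirected edge `xy` such that `G - xy` is not connected. -/
def IsBridge (G : MixedGraph V) (x y : V) : Prop :=
  G.Edge x y ∧ ¬ (G.deleteEdge x y).Connected

/-- A mixed graph is bridgeless if it is connected and has no bridge. -/
def Bridgeless (G : MixedGraph V) : Prop :=
  G.Connected ∧ ∀ x y, ¬ G.IsBridge x y

/-- A mixed graph is undirected if it has no directed edge. -/
def IsUndirected (G : MixedGraph V) : Prop :=
  ∀ x y, ¬ G.Arc x y

/-- A mixed graph is directed if every edge is a directed edge. -/
def IsDirected (G : MixedGraph V) : Prop :=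
  ∀ x y, ¬ G.Edge x y

/-- A strongly connected graph: connected, with every edge directed. -/
def StronglyConnected (G : MixedGraph V) : Prop :=
  G.IsDirected ∧ G.Connected

/-- The out-degree `d⁺`. -/
noncomputable def outDegree (G : MixedGraph V) (x : V) : ℕ :=
  {y | G.Arc x y}.ncard

/-- The in-degree `d⁻`. -/
noncomputable def inDegree (G : MixedGraph V) (x : V) : ℕ :=
  {y | G.Arc y x}.ncard

/-- The undirected degree `d*`. -/
noncomputable def undirDegree (G : MixedGraph V) (x : V) : ℕ :=
  {y | G.Edge x y}.ncard

/-- The maximum undirected degree `Δ*`. -/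
noncomputable def maxUndirDegree [Fintype V] (G : MixedGraph V) : ℕ :=
  Finset.univ.sup G.undirDegree

/-- The distance from `x` to `y`: the least number of edges of an orientable path from `x` to `y`
(`⊤` if there is none). -/
noncomputable def dist (G : MixedGraph V) (x y : V) : ℕ∞ :=
  ⨅ (k : ℕ) (_ : G.HasPath x y k), (k : ℕ∞)

/-- The diameter: the maximum of the distances over all ordered pairs of vertices. -/
noncomputable def diam (G : MixedGraph V) : ℕ∞ :=
  ⨆ (x : V) (y : V), G.dist x y

/-- `D` is an orientation of `G`: every undirected edge of `G` is given one direction (exactly one,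
since `D` is a mixed graph), and the directed edges of `G` are kept; `D` has no other edges. -/
def IsOrientation (G D : MixedGraph V) : Prop :=
  D.IsDirected ∧
  (∀ x y, G.Arc x y → D.Arc x y) ∧
  (∀ x y, G.Edge x y → D.Arc x y ∨ D.Arc y x) ∧
  (∀ x y, D.Arc x y → G.Step x y)

/-- `D` is a strong orientation of `G`. -/
def IsStrongOrientation (G D : MixedGraph V) : Prop :=
  G.IsOrientation D ∧ D.StronglyConnected

/-- The oriented diameter: the minimum of the diameters of the strong orientations of `G`, and `⊤`
if there is no strong orientation. In particular, a finite upper bound on it includes the existence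
of a strong orientation. -/
noncomputable def orientedDiam (G : MixedGraph V) : ℕ∞ :=
  ⨅ (D : MixedGraph V) (_ : G.IsStrongOrientation D), D.diam

/-- The natural-number subtraction `n - Δ*` never truncates. -/
theorem maxUndirDegree_lt_card [Fintype V] [Nonempty V] (G : MixedGraph V) :
    G.maxUndirDegree < Fintype.card V := by
  unfold maxUndirDegree
  rw [Finset.sup_lt_iff (by simpa using Fintype.card_pos)]
  intro x _
  unfold undirDegree
  rw [← Nat.card_eq_fintype_card, ← Set.ncard_univ]
  refine Set.ncard_lt_ncard ?_ (Set.toFinite _)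
  refine (Set.ssubset_univ_iff).2 fun h => G.edge_irrefl x ?_
  have : x ∈ {y | G.Edge x y} := h ▸ Set.mem_univ x
  exact this

end MixedGraph

/-! Fix a vertex `u` of maximum undirected degree and let `N` be the set of its undirected
neighbours. A path meeting `N` in at most `k` vertices has at most `n - Δ* + k` vertices. So it
suffices to find a strong orientation in which every vertex reaches `u`, and is reached from `u`, by
walks with few visits to `N`. `Near` records this weight; by `dist_le_of_near`, weights `k` towards
`u` and `l` away from `u` bound distances by `n - Δ* + k + l - 1`.

Only a core `H` containing `u` and `N` is oriented by hand. It grows by ears with inner vertices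
outside `N`, available because no edge `uv` is a bridge. The Boesch–Tindell theorem orients the
rest, and vertices outside the core are joined to it at no extra weight
(`Bridgeless.exists_isStrongOrientation_near`).

In general the weights are 3 and 2 (`IsCore.exists_extension`), which gives `n - Δ* + 4`. If there
are no arcs, ears can be reversed and both weights are 2 (`exists_isCore_of_symm`). If an arc joins
`u` and `t`, the core starts with a closed walk of weight 1 through that arc; afterwards weight 3
towards `u`, or 2 away from it, is needed only for walks avoiding `t`, so in the worst case the
saved vertex `t` pays for the extra unit. -/

open Relation

/-! ### Walks, reachability inside a set, and ears. -/

/-- A walk from `x` to `y` with at least one step all of whose inner vertices lie in `Z`. -/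
inductive InnerWalk {V : Type*} (S : V → V → Prop) (Z : Set V) : V → V → Prop
  | single {x y : V} : S x y → InnerWalk S Z x y
  | cons {x c y : V} : S x c → c ∈ Z → InnerWalk S Z c y → InnerWalk S Z x y

namespace InnerWalk

variable {V : Type*} {S : V → V → Prop}

theorem mono {Z Z' : Set V} (h : Z ⊆ Z') {x y : V} (p : InnerWalk S Z x y) :
    InnerWalk S Z' x y := by
  induction p with
  | single h1 => exact single h1
  | cons h1 h2 _ ih => exact cons h1 (h h2) ih

/-- If the walk passes through `c`, keep only what follows the last passage. -/
theorem cut {Z : Set V} (c : V) {x y : V} (p : InnerWalk S Z x y) :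
    InnerWalk S (Z \ {c}) x y ∨ InnerWalk S (Z \ {c}) c y := by
  induction p with
  | single h1 => exact .inl (single h1)
  | @cons x d y h1 h2 _ ih =>
    rcases ih with ih | ih
    · by_cases hd : d = c
      · subst hd; exact .inr ih
      · exact .inl (cons h1 ⟨h2, hd⟩ ih)
    · exact .inr ih

theorem of_restrict {Z W : Set V} {x y : V}
    (p : InnerWalk (fun a b => S a b ∧ b ∈ W) Z x y) : InnerWalk S (Z ∩ W) x y := by
  induction p with
  | single h1 => exact single h1.1
  | cons h1 h2 _ ih => exact cons h1.1 ⟨h2, h1.2⟩ ih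

/-- The inner vertices may be taken different from the first vertex. -/
theorem diff_start {Z : Set V} {x y : V} (p : InnerWalk S Z x y) :
    InnerWalk S (Z \ {x}) x y :=
  (p.cut x).elim id id

/-- Induction on the size of the set of inner vertices. -/
theorem cases_diff {Z : Set V} {x y : V} (p : InnerWalk S Z x y) :
    S x y ∨ ∃ c ∈ Z, S x c ∧ InnerWalk S (Z \ {c}) c y := by
  cases p with
  | single h => exact .inl h
  | cons h1 h2 h3 => exact .inr ⟨_, h2, h1, h3.diff_start⟩

/-- The part of a walk up to the first vertex in `A`. -/
theorem of_reflTransGen {A : Set V} {x y : V} (h : ReflTransGen S x y) (hx : x ∉ A)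
    (hy : y ∈ A) : ∃ w ∈ A, InnerWalk S (Aᶜ \ {x}) x w := by
  have : x ∈ A ∨ ∃ w ∈ A, InnerWalk S Aᶜ x w := by
    induction h using ReflTransGen.head_induction_on with
    | refl => exact .inl hy
    | @head a c hac _ ih =>
      by_cases hc : c ∈ A
      · exact .inr ⟨c, hc, single hac⟩
      · obtain ⟨w, hw, p⟩ := (ih hc).resolve_left hc
        exact .inr ⟨w, hw, cons hac hc p⟩
  obtain ⟨w, hw, p⟩ := this.resolve_left hx
  exact ⟨w, hw, p.diff_start⟩

end InnerWalk

/-- `y` is reachable from `x` along `R` inside `W`. -/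
def Linked {V : Type*} (R : V → V → Prop) (W : Set V) (x y : V) : Prop :=
  x ∈ W ∧ ReflTransGen (fun a b => R a b ∧ b ∈ W) x y

namespace Linked

variable {V : Type*} {R R' : V → V → Prop} {W W' : Set V} {x y z : V}

theorem refl (h : x ∈ W) : Linked R W x x := ⟨h, .refl⟩

theorem mono (hR : ∀ a b, R a b → R' a b) (hW : W ⊆ W') (h : Linked R W x y) :
    Linked R' W' x y :=
  ⟨hW h.1, ReflTransGen.mono (fun _ _ hab => ⟨hR _ _ hab.1, hW hab.2⟩) _ _ h.2⟩

theorem right_mem (h : Linked R W x y) : y ∈ W := by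
  rcases h.2.cases_tail with h' | ⟨_, _, h'⟩
  · exact h' ▸ h.1
  · exact h'.2

theorem trans (h : Linked R W x y) (h' : Linked R W y z) : Linked R W x z :=
  ⟨h.1, h.2.trans h'.2⟩

theorem single (h : R x y) (hx : x ∈ W) (hy : y ∈ W) : Linked R W x y :=
  ⟨hx, .single ⟨h, hy⟩⟩

theorem swap (h : Linked R W x y) : Linked (Function.swap R) W y x := by
  refine ⟨h.right_mem, ?_⟩
  obtain ⟨hx, h⟩ := h
  induction h with
  | refl => exact .refl
  | @tail b c hb hbc ih =>
    refine .head ⟨hbc.1, ?_⟩ ih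
    exact Linked.right_mem ⟨hx, hb⟩

end Linked

/-- `E` is the set of arcs of a path from `v` to `w` with set `C ⊆ Z` of inner vertices. -/
structure IsEar {V : Type*} (S : V → V → Prop) (Z : Set V) (v w : V) (E : V → V → Prop)
    (C : Set V) : Prop where
  inner : C ⊆ Z
  asymm : ∀ x y, E x y → ¬ E y x
  le : ∀ x y, E x y → S x y
  source : ∀ x y, E x y → x ∈ insert v C
  target : ∀ x y, E x y → y ∈ insert w C
  from_start : ∀ c ∈ C, Linked E (insert v C) v c
  to_end : ∀ c ∈ C, Linked E (insert w C) c w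
  through : Linked E (insert v (insert w C)) v w

/-- Induction on the size of `Z`: after the first step to `c`, the remaining walk can be taken with
inner vertices in `Z \ {c}`. No vertex is repeated, which is what makes the arcs asymmetric. -/
theorem InnerWalk.exists_isEar {V : Type*} [Finite V] {S : V → V → Prop} (n : ℕ) :
    ∀ {Z : Set V} {v w : V}, Z.ncard = n → InnerWalk S Z v w → v ∉ Z → w ∉ Z → v ≠ w →
      ∃ E C, IsEar S Z v w E C := by
  induction n with
  | zero =>
    intro Z v w hZ p hv hw hvw
    have hZ' : Z = ∅ := (Set.ncard_eq_zero).1 hZ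
    subst hZ'
    have hs : S v w := by
      rcases p.cases_diff with h | ⟨c, hc, _⟩
      · exact h
      · exact hc.elim
    refine ⟨fun a b => a = v ∧ b = w, ∅, ?_⟩
    constructor
    · simp
    · rintro x y ⟨rfl, rfl⟩ ⟨h, _⟩; exact hvw h.symm
    · rintro x y ⟨rfl, rfl⟩; exact hs
    · rintro x y ⟨rfl, rfl⟩; simp
    · rintro x y ⟨rfl, rfl⟩; simp
    · simp
    · simp
    · exact .single ⟨rfl, rfl⟩ (by simp) (by simp)
  | succ n ih =>
    intro Z v w hZ p hv hw hvw
    rcases p.cases_diff with hs | ⟨c, hc, hvc, p'⟩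
    · refine ⟨fun a b => a = v ∧ b = w, ∅, ?_⟩
      constructor
      · simp
      · rintro x y ⟨rfl, rfl⟩ ⟨h, _⟩; exact hvw h.symm
      · rintro x y ⟨rfl, rfl⟩; exact hs
      · rintro x y ⟨rfl, rfl⟩; simp
      · rintro x y ⟨rfl, rfl⟩; simp
      · simp
      · simp
      · exact .single ⟨rfl, rfl⟩ (by simp) (by simp)
    have hcw : c ≠ w := fun h => hw (h ▸ hc)
    have hcv : c ≠ v := fun h => hv (h ▸ hc)
    obtain ⟨E, C, hE⟩ := ih (Z := Z \ {c}) (by rw [Set.ncard_sdiff_singleton_of_mem hc, hZ]; rfl) p'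
      (by simp) (fun h => hw h.1) hcw
    have hvC : v ∉ C := fun h => hv (hE.inner h).1
    have hE' : ∀ a b, E a b → E a b ∨ (a = v ∧ b = c) := fun a b h => .inl h
    have hvc' : Linked (fun a b => E a b ∨ (a = v ∧ b = c)) (insert v (insert c C)) v c :=
      .single (.inr ⟨rfl, rfl⟩) (by simp) (by simp)
    refine ⟨fun a b => E a b ∨ (a = v ∧ b = c), insert c C, ?_⟩
    constructor
    · intro d hd
      rcases hd with rfl | hd
      · exact hc
      · exact (hE.inner hd).1
    · have hvE : ∀ a, ¬ E a v := fun a h => (hE.target _ _ h).elim hvw hvC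
      rintro x y (h | ⟨h1, h2⟩) (h' | ⟨h3, h4⟩)
      · exact hE.asymm _ _ h h'
      · subst h3; exact hvE _ h
      · subst h1; exact hvE _ h'
      · exact hcv (h2.symm.trans h3)
    · rintro x y (h | ⟨rfl, rfl⟩)
      · exact hE.le _ _ h
      · exact hvc
    · rintro x y (h | ⟨rfl, rfl⟩)
      · exact .inr (hE.source _ _ h)
      · simp
    · rintro x y (h | ⟨rfl, rfl⟩)
      · rcases hE.target _ _ h with h | h <;> simp [h]
      · simp
    · rintro d (rfl | hd)
      · exact hvc'
      · exact hvc'.trans ((hE.from_start d hd).mono hE' (Set.subset_insert _ _))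
    · rintro d (rfl | hd)
      · refine hE.through.mono hE' ?_
        rw [Set.insert_comm]
      · exact (hE.to_end d hd).mono hE' (Set.insert_subset_insert (Set.subset_insert _ _))
    · refine (hvc'.mono (fun _ _ h => h) ?_).trans (hE.through.mono hE' ?_)
      · exact Set.insert_subset_insert (Set.subset_insert _ _)
      · rw [Set.insert_comm c w]; exact Set.subset_insert _ _

/-! ### Orientable paths and reachability. -/

namespace MixedGraph

variable {V : Type*}

theorem HasPath.reflTransGen {G : MixedGraph V} {x y : V} {k : ℕ} (h : G.HasPath x y k) :
    ReflTransGen G.Step x y := by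
  obtain ⟨p, _, rfl, rfl, hs⟩ := h
  have : ∀ i : Fin (k + 1), ReflTransGen G.Step (p 0) (p i) := by
    intro i
    induction i using Fin.induction with
    | zero => exact .refl
    | succ i ih => exact ih.tail (hs i)
  exact this _

theorem _root_.InnerWalk.exists_path [Finite V] {G : MixedGraph V} (n : ℕ) :
    ∀ {Z : Set V} {x y : V}, Z.ncard = n → InnerWalk G.Step Z x y → x ∉ Z → y ∉ Z → x ≠ y →
      ∃ k ≤ n + 1, ∃ p : Fin (k + 1) → V, Function.Injective p ∧ p 0 = x ∧ p (Fin.last k) = y ∧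
        (∀ i : Fin k, G.Step (p i.castSucc) (p i.succ)) ∧ ∀ i, p i ∈ insert x (insert y Z) := by
  have base : ∀ {Z : Set V} {x y : V}, G.Step x y → x ≠ y →
      ∃ p : Fin (1 + 1) → V, Function.Injective p ∧ p 0 = x ∧ p (Fin.last 1) = y ∧
        (∀ i : Fin 1, G.Step (p i.castSucc) (p i.succ)) ∧ ∀ i, p i ∈ insert x (insert y Z) := by
    intro Z x y h hxy
    refine ⟨![x, y], ?_, rfl, rfl, ?_, ?_⟩
    · intro i j hij
      fin_cases i <;> fin_cases j <;> simp_all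
    · intro i
      fin_cases i
      exact h
    · intro i
      fin_cases i <;> simp
  induction n with
  | zero =>
    intro Z x y hZ q hx hy hxy
    have hZ' : Z = ∅ := (Set.ncard_eq_zero).1 hZ
    subst hZ'
    rcases q.cases_diff with h | ⟨c, hc, _⟩
    · exact ⟨1, le_rfl, base h hxy⟩
    · exact hc.elim
  | succ n ih =>
    intro Z x y hZ q hx hy hxy
    rcases q.cases_diff with h | ⟨c, hc, hxc, q'⟩
    · exact ⟨1, by omega, base h hxy⟩
    obtain ⟨k, hk, p, hp, h0, hl, hs, hm⟩ :=
      ih (Z := Z \ {c}) (by rw [Set.ncard_sdiff_singleton_of_mem hc, hZ]; rfl) q'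
      (by simp) (fun h => hy h.1) (fun h => hy (h ▸ hc))
    refine ⟨k + 1, by omega, Fin.cons x p, ?_, rfl, ?_, ?_, ?_⟩
    · rw [Fin.cons_injective_iff]
      refine ⟨?_, hp⟩
      rintro ⟨i, hi⟩
      have := hm i
      rw [hi] at this
      rcases this with h | h | h
      · exact hx (h ▸ hc)
      · exact hxy h
      · exact hx h.1
    · rw [← Fin.succ_last, Fin.cons_succ, hl]
    · intro i
      refine Fin.cases ?_ (fun j => ?_) i
      · simpa [h0] using hxc
      · simpa using hs j
    · intro i
      refine Fin.cases (by simp) (fun j => ?_) i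
      rw [Fin.cons_succ]
      rcases hm j with h | h | h
      · rw [h]; simp [hc]
      · rw [h]; simp
      · exact .inr (.inr h.1)

/-- A path inside `W` uses each vertex of `W` at most once. This turns vertex counts into lengths;
the `+ 1` is the excess of vertices over edges. -/
theorem hasPath_of_linked [Finite V] {G : MixedGraph V} {W : Set V} {x y : V}
    (h : Linked G.Step W x y) : ∃ k, k + 1 ≤ W.ncard ∧ G.HasPath x y k := by
  classical
  by_cases hxy : x = y
  · subst hxy
    refine ⟨0, ?_, fun _ => x, fun i j _ => by omega, rfl, rfl, fun i => i.elim0⟩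
    exact (Set.ncard_pos (Set.toFinite W)).2 ⟨x, h.1⟩
  have hw : ReflTransGen (fun a b => G.Step a b ∧ b ∈ W) x y := h.2
  obtain ⟨w, hwy, q⟩ := InnerWalk.of_reflTransGen (A := {y}) hw (by simpa using hxy) rfl
  have hwy : w = y := hwy
  subst hwy
  have q' : InnerWalk G.Step ((W \ {w}) \ {x}) x w := by
    refine q.of_restrict.diff_start.mono (fun a ha => ?_)
    exact ⟨⟨ha.1.2, ha.1.1.1⟩, ha.2⟩
  obtain ⟨k, hk, p, hp, h0, hl, hs, _⟩ :=
    InnerWalk.exists_path _ rfl q' (by simp) (by simp) hxy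
  refine ⟨k, ?_, p, hp, h0, hl, hs⟩
  have h1 : w ∈ W := h.right_mem
  have h2 : x ∈ W \ {w} := ⟨h.1, hxy⟩
  have e1 := Set.ncard_sdiff_singleton_add_one h1
  have e2 := Set.ncard_sdiff_singleton_add_one h2
  omega

theorem connected_iff [Finite V] {G : MixedGraph V} :
    G.Connected ↔ ∀ x y, ReflTransGen G.Step x y := by
  constructor
  · intro h x y
    obtain ⟨k, hk⟩ := h x y
    exact hk.reflTransGen
  · intro h x y
    obtain ⟨k, _, hk⟩ := hasPath_of_linked (G := G) (W := Set.univ)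
      ⟨Set.mem_univ x, ReflTransGen.mono (fun _ _ h => ⟨h, Set.mem_univ _⟩) _ _ (h x y)⟩
    exact ⟨k, hk⟩

end MixedGraph

/-! ### Strong orientations extending a given partial orientation. -/

namespace MixedGraph

variable {V : Type*}

theorem not_step_of_arc {G : MixedGraph V} {x y : V} (h : G.Arc x y) : ¬ G.Step y x := by
  rintro (h' | h')
  · exact G.not_arc_of_edge _ _ (G.edge_symm _ _ h') h
  · exact G.arc_asymm _ _ h h'

/-- The undirected edges that carry a step of `R` receive the direction given by `R`. -/
def orientAlong (G : MixedGraph V) (R : V → V → Prop) (asymm : ∀ a b, R a b → ¬ R b a)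
    (le : ∀ a b, R a b → G.Step a b) : MixedGraph V where
  Edge a b := G.Edge a b ∧ ¬ R a b ∧ ¬ R b a
  Arc a b := G.Arc a b ∨ R a b
  edge_symm a b h := ⟨G.edge_symm _ _ h.1, h.2.2, h.2.1⟩
  edge_irrefl a h := G.edge_irrefl a h.1
  arc_irrefl a h := h.elim (G.arc_irrefl a) fun h => asymm _ _ h h
  arc_asymm a b h h' := by
    rcases h with h | h <;> rcases h' with h' | h'
    · exact G.arc_asymm _ _ h h'
    · exact not_step_of_arc h (le _ _ h')
    · exact not_step_of_arc h' (le _ _ h)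
    · exact asymm _ _ h h'
  not_arc_of_edge a b h h' := h'.elim (G.not_arc_of_edge _ _ h.1) h.2.1

section orientAlong

variable {G : MixedGraph V} {R : V → V → Prop} {asymm : ∀ a b, R a b → ¬ R b a}
  {le : ∀ a b, R a b → G.Step a b}

theorem step_orientAlong {a b : V} (h : G.Step a b) :
    (G.orientAlong R asymm le).Step a b ∨ R b a := by
  by_cases h1 : R b a
  · exact .inr h1
  by_cases h2 : R a b
  · exact .inl (.inr (.inr h2))
  rcases h with h | h
  · exact .inl (.inl ⟨h, h2, h1⟩)
  · exact .inl (.inr (.inl h))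

theorem IsOrientation.of_orientAlong {D : MixedGraph V}
    (h : (G.orientAlong R asymm le).IsOrientation D) :
    G.IsOrientation D ∧ ∀ a b, R a b → D.Arc a b := by
  obtain ⟨h1, h2, h3, h4⟩ := h
  refine ⟨⟨h1, fun a b hab => h2 _ _ (.inl hab), fun a b hab => ?_, fun a b hab => ?_⟩,
    fun a b hab => h2 _ _ (.inr hab)⟩
  · by_cases ha : R a b
    · exact .inl (h2 _ _ (.inr ha))
    by_cases hb : R b a
    · exact .inr (h2 _ _ (.inr hb))
    exact h3 _ _ ⟨hab, ha, hb⟩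
  · rcases h4 _ _ hab with h | h | h
    · exact .inl h.1
    · exact .inr h
    · exact le _ _ h

/-- Only steps against `R` are lost, and `hR` supplies a detour for each of them. -/
theorem reflTransGen_orientAlong (hR : ∀ a b, R a b → ReflTransGen (G.orientAlong R asymm le).Step b a)
    {x y : V} (h : ReflTransGen G.Step x y) :
    ReflTransGen (G.orientAlong R asymm le).Step x y := by
  induction h with
  | refl => exact .refl
  | tail _ hbc ih =>
    rcases step_orientAlong (asymm := asymm) (le := le) hbc with h | h
    · exact ih.tail h
    · exact ih.trans (hR _ _ h)

/-- Orienting edges leaves the underlying graph unchanged; `p` will say that a given edge is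
avoided. -/
theorem reflTransGen_symm_orientAlong {p : V → V → Prop} {x y : V}
    (h : ReflTransGen (fun a b => (G.Step a b ∨ G.Step b a) ∧ p a b) x y) :
    ReflTransGen (fun a b => ((G.orientAlong R asymm le).Step a b ∨
      (G.orientAlong R asymm le).Step b a) ∧ p a b) x y := by
  refine ReflTransGen.mono ?_ _ _ h
  rintro a b ⟨h | h, hp⟩
  · rcases step_orientAlong (asymm := asymm) (le := le) h with h | h
    · exact ⟨.inl h, hp⟩
    · exact ⟨.inr (.inr (.inr h)), hp⟩
  · rcases step_orientAlong (asymm := asymm) (le := le) h with h | h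
    · exact ⟨.inr h, hp⟩
    · exact ⟨.inl (.inr (.inr h)), hp⟩

end orientAlong

/-- If `G` is connected and the underlying graph stays connected without the edge `xy`, then one
end of `xy` can be reached from the other without using `xy`. -/
theorem reflTransGen_deleteEdge_or {G : MixedGraph V} (hG : ∀ x y, ReflTransGen G.Step x y)
    {x y : V} (h : ReflTransGen (fun a b => (G.Step a b ∨ G.Step b a) ∧ s(a, b) ≠ s(x, y)) x y) :
    ReflTransGen (fun a b => G.Step a b ∧ s(a, b) ≠ s(x, y)) y x ∨
      ReflTransGen (fun a b => G.Step a b ∧ s(a, b) ≠ s(x, y)) x y := by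
  by_contra! hcon
  obtain ⟨hyx, hxy⟩ := hcon
  set r : V → V → Prop := fun a b => G.Step a b ∧ s(a, b) ≠ s(x, y) with hr
  -- If neither end reaches the other, the sets reached from `x` and from `y` without the edge
  -- partition the vertices. The former is then closed under backward steps too, so the underlying
  -- connection forces `y` into it.
  have cover : ∀ z, ReflTransGen r x z ∨ ReflTransGen r y z := by
    intro z
    induction hG x z with
    | refl => exact .inl .refl
    | @tail b c _ hbc ih =>
      by_cases he : s(b, c) = s(x, y)
      · rcases Sym2.eq_iff.1 he with ⟨_, rfl⟩ | ⟨_, rfl⟩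
        · exact .inr .refl
        · exact .inl .refl
      · exact ih.imp (fun h => h.tail ⟨hbc, he⟩) fun h => h.tail ⟨hbc, he⟩
  have disj : ∀ z, ReflTransGen r x z → ReflTransGen r y z → False := by
    intro z
    induction hG z x using ReflTransGen.head_induction_on with
    | refl => exact fun _ h => hyx h
    | @head b c hbc _ ih =>
      intro h1 h2
      have he : s(b, c) ≠ s(x, y) := by
        intro he
        rcases Sym2.eq_iff.1 he with ⟨rfl, _⟩ | ⟨rfl, _⟩
        · exact hyx h2
        · exact hxy h1
      exact ih (h1.tail ⟨hbc, he⟩) (h2.tail ⟨hbc, he⟩)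
  have : ∀ z, ReflTransGen (fun a b => (G.Step a b ∨ G.Step b a) ∧ s(a, b) ≠ s(x, y)) x z →
      ReflTransGen r x z := by
    intro z hz
    induction hz with
    | refl => exact .refl
    | @tail b c _ hbc ih =>
      obtain ⟨hbc | hbc, he⟩ := hbc
      · exact ih.tail ⟨hbc, he⟩
      · rcases cover c with hc | hc
        · exact hc
        · exact (disj b ih (hc.tail ⟨hbc, by rwa [Sym2.eq_swap]⟩)).elim
  exact hxy (this y h)

/-- The theorem of Boesch and Tindell. -/
theorem exists_orientation_of_no_cut_edge [Finite V] (n : ℕ) : ∀ G : MixedGraph V,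
    {p : V × V | G.Edge p.1 p.2}.ncard = n → (∀ x y, ReflTransGen G.Step x y) →
    (∀ x y, G.Edge x y →
      ReflTransGen (fun a b => (G.Step a b ∨ G.Step b a) ∧ s(a, b) ≠ s(x, y)) x y) →
    ∃ D, G.IsOrientation D ∧ ∀ x y, ReflTransGen D.Step x y := by
  induction n using Nat.strong_induction_on with
  | _ n ih =>
  intro G hn hG hE
  by_cases hd : G.IsDirected
  · exact ⟨G, ⟨hd, fun _ _ h => h, fun x y h => (hd x y h).elim, fun _ _ h => .inr h⟩, hG⟩
  obtain ⟨x, y, hxy, hyx⟩ : ∃ x y, G.Edge x y ∧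
      ReflTransGen (fun a b => G.Step a b ∧ s(a, b) ≠ s(x, y)) y x := by
    simp only [IsDirected, not_forall, not_not] at hd
    obtain ⟨x, y, hxy⟩ := hd
    rcases reflTransGen_deleteEdge_or hG (hE x y hxy) with h | h
    · exact ⟨x, y, hxy, h⟩
    · exact ⟨y, x, G.edge_symm _ _ hxy, by rwa [Sym2.eq_swap]⟩
  have hne : x ≠ y := fun h => G.edge_irrefl x (by rwa [← h] at hxy)
  let R : V → V → Prop := fun a b => a = x ∧ b = y
  have asymm : ∀ a b, R a b → ¬ R b a := by
    rintro a b ⟨rfl, rfl⟩ ⟨h, _⟩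
    exact hne h.symm
  have le : ∀ a b, R a b → G.Step a b := by
    rintro a b ⟨rfl, rfl⟩
    exact .inl hxy
  have hback : ∀ a b, R a b → ReflTransGen (G.orientAlong R asymm le).Step b a := by
    rintro a b ⟨rfl, rfl⟩
    refine ReflTransGen.mono ?_ _ _ hyx
    rintro c d ⟨hcd, he⟩
    refine (step_orientAlong hcd).resolve_right ?_
    rintro ⟨rfl, rfl⟩
    exact he Sym2.eq_swap
  -- The induction carries the condition on the underlying graph because bridgelessness itself can
  -- be lost when an edge is oriented.
  obtain ⟨D, hD, hD'⟩ := ih _ (by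
    rw [← hn]
    refine Set.ncard_lt_ncard ?_ (Set.toFinite _)
    refine ⟨fun p hp => hp.1, fun h => ?_⟩
    exact (h (a := (x, y)) hxy).2.1 ⟨rfl, rfl⟩) (G.orientAlong R asymm le) rfl
    (fun a b => reflTransGen_orientAlong hback (hG a b))
    (fun a b hab => reflTransGen_symm_orientAlong (hE a b hab.1))
  exact ⟨D, hD.of_orientAlong.1, hD'⟩

theorem Bridgeless.reflTransGen [Finite V] {G : MixedGraph V} (hG : G.Bridgeless) {x y : V}
    (hxy : G.Edge x y) (a b : V) : ReflTransGen (G.deleteEdge x y).Step a b :=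
  connected_iff.1 (not_not.1 fun h => hG.2 x y ⟨hxy, h⟩) a b

/-- A strong orientation of a part of a bridgeless mixed graph extends to a strong orientation of
the whole graph. -/
theorem Bridgeless.exists_isStrongOrientation [Finite V] {G : MixedGraph V} (hG : G.Bridgeless)
    {R : V → V → Prop} (asymm : ∀ a b, R a b → ¬ R b a) (le : ∀ a b, R a b → G.Step a b)
    (strong : ∀ a b, R a b → ReflTransGen R b a) :
    ∃ D, G.IsStrongOrientation D ∧ ∀ a b, R a b → D.Arc a b := by
  obtain ⟨D, hD, hD'⟩ := exists_orientation_of_no_cut_edge _ (G.orientAlong R asymm le) rfl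
    (fun a b => reflTransGen_orientAlong
      (fun a b hab => ReflTransGen.mono (fun c d h => .inr (.inr h)) _ _ (strong a b hab))
      (connected_iff.1 hG.1 a b))
    (fun x y hxy => reflTransGen_symm_orientAlong (by
      refine ReflTransGen.mono ?_ _ _ (hG.reflTransGen hxy.1 x y)
      rintro a b (h | h)
      · exact ⟨.inl (.inl h.1), h.2⟩
      · refine ⟨.inl (.inr h), fun he => ?_⟩
        rcases Sym2.eq_iff.1 he with ⟨rfl, rfl⟩ | ⟨rfl, rfl⟩
        · exact G.not_arc_of_edge _ _ hxy.1 h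
        · exact G.not_arc_of_edge _ _ (G.edge_symm _ _ hxy.1) h))
  exact ⟨D, ⟨hD.of_orientAlong.1, hD.1, connected_iff.2 hD'⟩, hD.of_orientAlong.2⟩

end MixedGraph

/-! ### Weights: walks counted by their visits to `N`. -/

/-- `y` can be reached from `x` along `R` by a walk that meets `N` in at most `k` vertices and
avoids `T`. -/
def Near {V : Type*} (R : V → V → Prop) (N T : Set V) (k : ℕ) (x y : V) : Prop :=
  ∃ W : Set V, (W ∩ N).ncard ≤ k ∧ Disjoint W T ∧ Linked R W x y

namespace Near

variable {V : Type*} {R R' : V → V → Prop} {N T T' : Set V} {k l : ℕ} {x y z : V}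

theorem mono (h : Near R N T k x y) (hR : ∀ a b, R a b → R' a b) (hT : T' ⊆ T) (hk : k ≤ l) :
    Near R' N T' l x y := by
  obtain ⟨W, h1, h2, h3⟩ := h
  exact ⟨W, h1.trans hk, h2.mono_right hT, h3.mono hR subset_rfl⟩

theorem swap (h : Near R N T k x y) : Near (Function.swap R) N T k y x := by
  obtain ⟨W, h1, h2, h3⟩ := h
  exact ⟨W, h1, h2, h3.swap⟩

theorem reflTransGen (h : Near R N T k x y) : ReflTransGen R x y := by
  obtain ⟨W, _, _, h3⟩ := h
  exact ReflTransGen.mono (fun _ _ h => h.1) _ _ h3.2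

theorem of_linked {A : Set V} (h : Linked R A x y) (hT : Disjoint A T)
    (hN : A ∩ N ⊆ {z}) : Near R N T 1 x y :=
  ⟨A, (Set.ncard_le_ncard hN).trans (by simp), hT, h⟩

theorem of_linked_pair {A : Set V} {z' : V} (h : Linked R A x y) (hT : Disjoint A T)
    (hN : A ∩ N ⊆ {z, z'}) : Near R N T 2 x y :=
  ⟨A, (Set.ncard_le_ncard hN).trans (Set.ncard_insert_le _ _ |>.trans (by simp)), hT, h⟩

theorem self (hN : x ∉ N) (hT : x ∉ T) : Near R N T k x x :=
  ⟨{x}, by simp [Set.singleton_inter_eq_empty.2 hN], by simpa using hT, .refl rfl⟩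

/-- The new vertices avoid `N` and `T`, so the weight does not change; in `prepend_succ` the first
vertex may lie in `N` and costs one. -/
theorem prepend [Finite V] {A : Set V} (h : Near R N T k y z) (hxy : Linked R' A x y)
    (hR : ∀ a b, R a b → R' a b) (hT : ∀ a ∈ A, a ≠ y → a ∉ T) (hN : ∀ a ∈ A, a ≠ y → a ∉ N) :
    Near R' N T k x z := by
  obtain ⟨W, h1, h2, h3⟩ := h
  refine ⟨A ∪ W, (Set.ncard_le_ncard ?_).trans h1, ?_,
    (hxy.mono (fun _ _ h => h) Set.subset_union_left).trans (h3.mono hR Set.subset_union_right)⟩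
  · rintro a ⟨ha | ha, haN⟩
    · by_cases hay : a = y
      · exact ⟨hay ▸ h3.1, haN⟩
      · exact (hN a ha hay haN).elim
    · exact ⟨ha, haN⟩
  · rw [Set.disjoint_left] at h2 ⊢
    rintro a (ha | ha)
    · by_cases hay : a = y
      · exact h2 (hay ▸ h3.1)
      · exact hT a ha hay
    · exact h2 ha

theorem prepend_succ [Finite V] {A : Set V} (h : Near R N T k y z) (hxy : Linked R' A x y)
    (hR : ∀ a b, R a b → R' a b) (hT : ∀ a ∈ A, a ≠ y → a ∉ T)
    (hN : ∀ a ∈ A, a ≠ y → a ≠ x → a ∉ N) : Near R' N T (k + 1) x z := by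
  obtain ⟨W, h1, h2, h3⟩ := h
  refine ⟨A ∪ W, (Set.ncard_le_ncard (t := insert x (W ∩ N)) ?_).trans
    ((Set.ncard_insert_le _ _).trans (by omega)), ?_,
    (hxy.mono (fun _ _ h => h) Set.subset_union_left).trans (h3.mono hR Set.subset_union_right)⟩
  · rintro a ⟨ha | ha, haN⟩
    · by_cases hay : a = y
      · exact .inr ⟨hay ▸ h3.1, haN⟩
      · by_cases hax : a = x
        · exact .inl hax
        · exact (hN a ha hay hax haN).elim
    · exact .inr ⟨ha, haN⟩
  · rw [Set.disjoint_left] at h2 ⊢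
    rintro a (ha | ha)
    · by_cases hay : a = y
      · exact h2 (hay ▸ h3.1)
      · exact hT a ha hay
    · exact h2 ha

end Near

/-! ### Cores, and the weights on an attached ear or cycle. -/

/-- A part `H ∋ u` of the vertex set together with a choice `R ⊆ S` of arcs between vertices of
`H`, no two of them opposite. -/
structure IsCore {V : Type*} (S : V → V → Prop) (u : V) (H : Set V) (R : V → V → Prop) :
    Prop where
  mem : u ∈ H
  asymm : ∀ a b, R a b → ¬ R b a
  le : ∀ a b, R a b → S a b
  source : ∀ a b, R a b → a ∈ H
  target : ∀ a b, R a b → b ∈ H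

namespace IsCore

variable {V : Type*} {S R E : V → V → Prop} {u v w : V} {H C Z N T : Set V}

theorem swap (h : IsCore S u H R) : IsCore (Function.swap S) u H (Function.swap R) where
  mem := h.mem
  asymm a b := h.asymm b a
  le a b := h.le b a
  source a b := h.target b a
  target a b := h.source b a

theorem trivial (S : V → V → Prop) (u : V) : IsCore S u {u} (fun _ _ => False) where
  mem := rfl
  asymm _ _ h := h.elim
  le _ _ h := h.elim
  source _ _ h := h.elim
  target _ _ h := h.elim

/-- Adding the arcs of a path from `v ∉ H` to `w ∈ H` and the arc `uv`. -/
theorem add_ear (h : IsCore S u H R) (hE : IsEar S Z v w E C) (hZ : Disjoint Z H) (hv : v ∉ H)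
    (hw : w ∈ H) (huv : S u v) (hvu : ¬ E v u) :
    IsCore S u (H ∪ insert v C) (fun a b => R a b ∨ E a b ∨ (a = u ∧ b = v)) := by
  have hCH : ∀ a ∈ C, a ∉ H := fun a ha => Set.disjoint_left.1 hZ (hE.inner ha)
  have hsrc : ∀ a b, E a b → a ∉ H := by
    intro a b hab
    rcases hE.source _ _ hab with rfl | h
    · exact hv
    · exact hCH a h
  have hu := h.mem
  constructor
  · exact .inl hu
  · rintro a b (h1 | h1 | ⟨rfl, rfl⟩) (h2 | h2 | ⟨h2, h3⟩)
    · exact h.asymm _ _ h1 h2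
    · exact hsrc _ _ h2 (h.target _ _ h1)
    · exact hv (h3 ▸ h.source _ _ h1)
    · exact hsrc _ _ h1 (h.target _ _ h2)
    · exact hE.asymm _ _ h1 h2
    · subst h2 h3; exact hvu h1
    · exact hv (h.source _ _ h2)
    · exact hvu h2
    · exact hv (h2 ▸ hu)
  · rintro a b (h1 | h1 | ⟨rfl, rfl⟩)
    exacts [h.le _ _ h1, hE.le _ _ h1, huv]
  · rintro a b (h1 | h1 | ⟨rfl, rfl⟩)
    exacts [.inl (h.source _ _ h1), .inr (hE.source _ _ h1), .inl hu]
  · rintro a b (h1 | h1 | ⟨rfl, rfl⟩)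
    · exact .inl (h.target _ _ h1)
    · rcases hE.target _ _ h1 with rfl | h1
      exacts [.inl hw, .inr (.inr h1)]
    · exact .inr (.inl rfl)

/-- Adding the arcs of a path from `v ∉ H` to `w ∉ H` and the arcs `uv`, `wu`. -/
theorem add_cycle (h : IsCore S u H R) (hE : IsEar S Z v w E C) (hZ : Disjoint Z H) (hv : v ∉ H)
    (hw : w ∉ H) (hvw : v ≠ w) (huv : S u v) (hwu : S w u) :
    IsCore S u (H ∪ insert v (insert w C))
      (fun a b => R a b ∨ E a b ∨ (a = u ∧ b = v) ∨ (a = w ∧ b = u)) := by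
  have hCH : ∀ a ∈ C, a ∉ H := fun a ha => Set.disjoint_left.1 hZ (hE.inner ha)
  have hsrc : ∀ a b, E a b → a ∉ H := by
    intro a b hab
    rcases hE.source _ _ hab with rfl | h
    · exact hv
    · exact hCH a h
  have htgt : ∀ a b, E a b → b ∉ H := by
    intro a b hab
    rcases hE.target _ _ hab with rfl | h
    · exact hw
    · exact hCH b h
  have hu := h.mem
  constructor
  · exact .inl hu
  · rintro a b (h1 | h1 | ⟨h0, h1⟩ | ⟨h0, h1⟩) (h2 | h2 | ⟨h2, h3⟩ | ⟨h2, h3⟩)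
    · exact h.asymm _ _ h1 h2
    · exact hsrc _ _ h2 (h.target _ _ h1)
    · exact hv (h3 ▸ h.source _ _ h1)
    · exact hw (h2 ▸ h.target _ _ h1)
    · exact hsrc _ _ h1 (h.target _ _ h2)
    · exact hE.asymm _ _ h1 h2
    · subst h2; exact htgt _ _ h1 hu
    · subst h3; exact hsrc _ _ h1 hu
    · exact hv (h1 ▸ h.source _ _ h2)
    · subst h0; exact htgt _ _ h2 hu
    · subst h0 h1; exact hv (h2 ▸ hu)
    · subst h1; exact hvw h2
    · exact hw (h0 ▸ h.target _ _ h2)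
    · subst h1; exact hsrc _ _ h2 hu
    · subst h0; exact hvw h3.symm
    · subst h0; exact hw (h3 ▸ hu)
  · rintro a b (h1 | h1 | ⟨rfl, rfl⟩ | ⟨rfl, rfl⟩)
    exacts [h.le _ _ h1, hE.le _ _ h1, huv, hwu]
  · rintro a b (h1 | h1 | ⟨rfl, rfl⟩ | ⟨rfl, rfl⟩)
    · exact .inl (h.source _ _ h1)
    · rcases hE.source _ _ h1 with rfl | h1
      exacts [.inr (.inl rfl), .inr (.inr (.inr h1))]
    · exact .inl hu
    · exact .inr (.inr (.inl rfl))
  · rintro a b (h1 | h1 | ⟨rfl, rfl⟩ | ⟨rfl, rfl⟩)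
    · exact .inl (h.target _ _ h1)
    · exact .inr (.inr (hE.target _ _ h1))
    · exact .inr (.inl rfl)
    · exact .inl hu

end IsCore

namespace IsEar

variable {V : Type*} {S S' R R' E : V → V → Prop} {u v w x : V} {H C Z Z' N T : Set V} {k : ℕ}

theorem mono (hE : IsEar S Z v w E C) (hS : ∀ a b, S a b → S' a b) (hZ : Z ⊆ Z') :
    IsEar S' Z' v w E C :=
  { hE with inner := hE.inner.trans hZ, le := fun a b h => hS _ _ (hE.le a b h) }

theorem linked_from (hE : IsEar S Z v w E C) (hER : ∀ a b, E a b → R a b) (huv : R u v)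
    (hx : x ∈ insert v C) : Linked R (insert u (insert v C)) u x := by
  refine (Linked.single huv (by simp) (by simp)).trans ?_
  rcases hx with rfl | hx
  · exact .refl (by simp)
  · exact (hE.from_start x hx).mono hER (Set.subset_insert _ _)

theorem linked_to (hE : IsEar S Z v w E C) (hER : ∀ a b, E a b → R a b) (hwu : R w u)
    (hx : x ∈ insert w C) : Linked R (insert u (insert w C)) x u := by
  refine .trans ?_ (Linked.single hwu (by simp) (by simp))
  rcases hx with rfl | hx
  · exact .refl (by simp)
  · exact (hE.to_end x hx).mono hER (Set.subset_insert _ _)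

theorem linked_from_end (hE : IsEar S Z v w E C) (hER : ∀ a b, E a b → R a b) (huv : R u v) :
    Linked R (insert u (insert v (insert w C))) u w :=
  (Linked.single huv (by simp) (by simp)).trans (hE.through.mono hER (Set.subset_insert _ _))

theorem linked_to_start (hE : IsEar S Z v w E C) (hER : ∀ a b, E a b → R a b) (hwu : R w u) :
    Linked R (insert u (insert v (insert w C))) v u :=
  (hE.through.mono hER (Set.subset_insert _ _)).trans (Linked.single hwu (by simp) (by simp))

theorem near_from (hE : IsEar S Z v w E C) (hER : ∀ a b, E a b → R a b) (huv : R u v)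
    (hZN : Disjoint Z N) (hZT : Disjoint Z T) (huN : u ∉ N) (huT : u ∉ T) (hvT : v ∉ T)
    (hx : x ∈ insert v C) : Near R N T 1 u x := by
  refine .of_linked (z := v) (hE.linked_from hER huv hx) ?_ ?_
  · rw [Set.disjoint_left]
    rintro a (rfl | rfl | ha)
    exacts [huT, hvT, Set.disjoint_left.1 hZT (hE.inner ha)]
  · rintro a ⟨rfl | rfl | ha, haN⟩
    exacts [(huN haN).elim, rfl, (Set.disjoint_left.1 hZN (hE.inner ha) haN).elim]

theorem near_to (hE : IsEar S Z v w E C) (hER : ∀ a b, E a b → R a b) (hwu : R w u)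
    (hZN : Disjoint Z N) (hZT : Disjoint Z T) (huN : u ∉ N) (huT : u ∉ T) (hwT : w ∉ T)
    (hx : x ∈ insert w C) : Near R N T 1 x u := by
  refine .of_linked (z := w) (hE.linked_to hER hwu hx) ?_ ?_
  · rw [Set.disjoint_left]
    rintro a (rfl | rfl | ha)
    exacts [huT, hwT, Set.disjoint_left.1 hZT (hE.inner ha)]
  · rintro a ⟨rfl | rfl | ha, haN⟩
    exacts [(huN haN).elim, rfl, (Set.disjoint_left.1 hZN (hE.inner ha) haN).elim]

/-- On the closed walk from `u` through `v` and `w` back to `u`, only `v` and `w` can lie in `N`.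
Only `v` may have to pass both on its way to `u`, and only `w` on the way from `u`. -/
theorem near_cycle (hE : IsEar S Z v w E C) (hER : ∀ a b, E a b → R a b) (huv : R u v)
    (hwu : R w u) (hZN : Disjoint Z N) (hZT : Disjoint Z T) (huN : u ∉ N) (huT : u ∉ T)
    (hvT : v ∉ T) (hwT : w ∉ T) (hx : x ∈ insert v (insert w C)) :
    (Near R N T 1 u x ∧ Near R N T 2 x u) ∨ (Near R N T 2 u x ∧ Near R N T 1 x u) := by
  have hT : Disjoint (insert u (insert v (insert w C))) T := by
    rw [Set.disjoint_left]
    rintro a (rfl | rfl | rfl | ha)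
    exacts [huT, hvT, hwT, Set.disjoint_left.1 hZT (hE.inner ha)]
  have hN : insert u (insert v (insert w C)) ∩ N ⊆ {v, w} := by
    rintro a ⟨rfl | rfl | rfl | ha, haN⟩
    exacts [(huN haN).elim, .inl rfl, .inr rfl,
      (Set.disjoint_left.1 hZN (hE.inner ha) haN).elim]
  have hfrom := fun hx => hE.near_from (x := x) hER huv hZN hZT huN huT hvT hx
  have hto := fun hx => hE.near_to (x := x) hER hwu hZN hZT huN huT hwT hx
  rcases hx with rfl | rfl | hx
  · exact .inl ⟨hfrom (.inl rfl), .of_linked_pair (hE.linked_to_start hER hwu) hT hN⟩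
  · exact .inr ⟨.of_linked_pair (hE.linked_from_end hER huv) hT hN, hto (.inl rfl)⟩
  · exact .inl ⟨hfrom (.inr hx), (hto (.inr hx)).mono (fun _ _ h => h) subset_rfl (by norm_num)⟩

variable [Finite V]

/-- Inner vertices lie outside `N` and inherit the weight of the end `w`; the start `v` pays at most
one more (`near_start`). -/
theorem near_inner (hE : IsEar S Z v w E C) (hER : ∀ a b, E a b → R' a b)
    (hRR : ∀ a b, R a b → R' a b) (hZN : Disjoint Z N) (hZT : Disjoint Z T)
    (hw : Near R N T k w u) (hx : x ∈ C) : Near R' N T k x u := by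
  refine hw.prepend ((hE.to_end x hx).mono hER subset_rfl) hRR ?_ ?_
  · rintro a (rfl | ha) h
    exacts [(h rfl).elim, Set.disjoint_left.1 hZT (hE.inner ha)]
  · rintro a (rfl | ha) h
    exacts [(h rfl).elim, Set.disjoint_left.1 hZN (hE.inner ha)]

theorem near_start (hE : IsEar S Z v w E C) (hER : ∀ a b, E a b → R' a b)
    (hRR : ∀ a b, R a b → R' a b) (hZN : Disjoint Z N) (hZT : Disjoint Z T) (hvT : v ∉ T)
    (hw : Near R N T k w u) : Near R' N T (k + 1) v u := by
  refine hw.prepend_succ (hE.through.mono hER subset_rfl) hRR ?_ ?_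
  · rintro a (rfl | rfl | ha) h
    exacts [hvT, (h rfl).elim, Set.disjoint_left.1 hZT (hE.inner ha)]
  · rintro a (rfl | rfl | ha) h h'
    exacts [(h' rfl).elim, (h rfl).elim, Set.disjoint_left.1 hZN (hE.inner ha)]

end IsEar

/-! ### Growing a core until it contains `N`. -/

section Stages

variable {V : Type*} [Finite V] {S : V → V → Prop} {u : V} {N : Set V}

/-- An ear from a vertex `v ∈ N` outside `H` to the first vertex in `H` or in `N`. -/
theorem exists_isEar_of_reflTransGen {H : Set V} {v : V} (huH : u ∈ H) (hvN : v ∈ N) (hvH : v ∉ H)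
    (h : ReflTransGen (fun a b => S a b ∧ ¬ (a = v ∧ b = u)) v u) :
    ∃ w E C, (w ∈ H ∨ w ∈ N \ H) ∧ v ≠ w ∧ IsEar S (H ∪ N)ᶜ v w E C ∧ ¬ E v u := by
  have hvu : v ≠ u := fun h => hvH (h ▸ huH)
  -- The start `v` is itself in `N`, so it is removed from the target set. Forbidding the step from
  -- `v` to `u` leaves room for the arc `uv`.
  obtain ⟨w, hw, p⟩ := InnerWalk.of_reflTransGen (A := (H ∪ N) \ {v}) h (by simp)
    ⟨.inl huH, hvu.symm⟩
  have hZ : ((H ∪ N) \ {v})ᶜ \ {v} ⊆ (H ∪ N)ᶜ := fun a ha ha' => ha.1 ⟨ha', ha.2⟩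
  have hvw : v ≠ w := fun h => hw.2 h.symm
  obtain ⟨E, C, hE⟩ := InnerWalk.exists_isEar _ rfl (p.mono hZ) (fun h => h (.inr hvN))
    (fun h => h hw.1) hvw
  refine ⟨w, E, C, ?_, hvw, hE.mono (fun _ _ h => h.1) subset_rfl, fun h => (hE.le _ _ h).2 ⟨rfl, rfl⟩⟩
  by_cases hwH : w ∈ H
  · exact .inl hwH
  · exact .inr ⟨hw.1.resolve_left hwH, hwH⟩

theorem exists_maximal_set {P : Set V → Prop} {H₀ : Set V} (h : P H₀) :
    ∃ H, P H ∧ ∀ H', P H' → H ⊆ H' → H' ⊆ H := by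
  obtain ⟨H, hH⟩ := (Set.toFinite {H | P H}).exists_maximal ⟨H₀, h⟩
  exact ⟨H, hH.1, fun H' h' hle => hH.2 h' hle⟩

variable (huN : u ∉ N) (hN : ∀ v ∈ N, S u v ∧ S v u)
  (hS : ∀ v ∈ N, ReflTransGen (fun a b => S a b ∧ ¬ (a = v ∧ b = u)) v u)

include huN hN hS

/-- A core whose vertices have weight at most one to and from `u` extends to a core containing `N`
whose vertices have weight at most three to `u` and at most two from `u`, where the extremal
weights are attained by walks avoiding `T`. -/
theorem IsCore.exists_extension {H₀ : Set V} {R₀ : V → V → Prop} (h₀ : IsCore S u H₀ R₀)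
    {T : Set V} (hT : T ⊆ H₀) (huT : u ∉ T)
    (h₁ : ∀ x ∈ H₀, Near R₀ N ∅ 1 x u ∧ Near R₀ N ∅ 1 u x) :
    ∃ H R, IsCore S u H R ∧ N ⊆ H ∧ T ⊆ H ∧ ∀ x ∈ H,
      (Near R N ∅ 2 x u ∨ Near R N T 3 x u) ∧ (Near R N ∅ 1 u x ∨ Near R N T 2 u x) := by
  -- First stage: weights at most two both ways, a class closed under adding cycles through `u` and
  -- two new vertices of `N`.
  obtain ⟨B, ⟨hTB, Q, hQ, hQ'⟩, hmax⟩ := exists_maximal_set (P := fun H => T ⊆ H ∧ ∃ R,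
    IsCore S u H R ∧ ∀ x ∈ H, (Near R N ∅ 1 x u ∨ Near R N T 2 x u) ∧
      (Near R N ∅ 1 u x ∨ Near R N T 2 u x))
    ⟨hT, R₀, h₀, fun x hx => ⟨.inl (h₁ x hx).1, .inl (h₁ x hx).2⟩⟩
  have noCycle : ∀ v ∈ N \ B, ∀ w ∈ N \ B, v ≠ w → ∀ Z E C, Z ⊆ (B ∪ N)ᶜ →
      ¬ IsEar S Z v w E C := by
    intro v hv w hw hvw Z E C hZ hE
    have hZB : Disjoint Z B := Set.disjoint_left.2 fun a ha h => hZ ha (.inl h)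
    have hZN : Disjoint Z N := Set.disjoint_left.2 fun a ha h => hZ ha (.inr h)
    have hc := hQ.add_cycle hE hZB hv.2 hw.2 hvw (hN v hv.1).1 (hN w hw.1).2
    refine hv.2 (hmax _ ⟨hTB.trans Set.subset_union_left, _, hc, ?_⟩ Set.subset_union_left
      (.inr (.inl rfl)))
    rintro x (hx | hx)
    · exact ⟨(hQ' x hx).1.imp (fun h => h.mono (fun _ _ h => .inl h) subset_rfl le_rfl)
        fun h => h.mono (fun _ _ h => .inl h) subset_rfl le_rfl,
        (hQ' x hx).2.imp (fun h => h.mono (fun _ _ h => .inl h) subset_rfl le_rfl)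
        fun h => h.mono (fun _ _ h => .inl h) subset_rfl le_rfl⟩
    · rcases hE.near_cycle (R := fun a b => Q a b ∨ E a b ∨ (a = u ∧ b = v) ∨ (a = w ∧ b = u))
        (u := u) (N := N) (T := T) (fun _ _ h => .inr (.inl h)) (.inr (.inr (.inl ⟨rfl, rfl⟩)))
        (.inr (.inr (.inr ⟨rfl, rfl⟩))) hZN (hZB.mono_right hTB) huN huT
        (fun h => hv.2 (hTB h)) (fun h => hw.2 (hTB h)) hx with h | h
      · exact ⟨.inr h.2, .inr (h.1.mono (fun _ _ h => h) subset_rfl (by norm_num))⟩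
      · exact ⟨.inr (h.2.mono (fun _ _ h => h) subset_rfl (by norm_num)), .inr h.1⟩
  -- Second stage: single ears are added, all entered from `u`. Weight three towards `u` is allowed
  -- only on `N \ B`.
  obtain ⟨H, ⟨hBH, R, hR, hR'⟩, hmaxH⟩ := exists_maximal_set (P := fun H => B ⊆ H ∧ ∃ R,
    IsCore S u H R ∧ ∀ x ∈ H, (Near R N ∅ 2 x u ∨ Near R N T 3 x u) ∧
      (x ∉ N \ B → Near R N ∅ 1 x u ∨ Near R N T 2 x u) ∧
      (Near R N ∅ 1 u x ∨ Near R N T 2 u x))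
    ⟨subset_rfl, Q, hQ, fun x hx => ⟨(hQ' x hx).1.imp
      (fun h => h.mono (fun _ _ h => h) subset_rfl (by norm_num))
      fun h => h.mono (fun _ _ h => h) subset_rfl (by norm_num),
      fun _ => (hQ' x hx).1, (hQ' x hx).2⟩⟩
  refine ⟨H, R, hR, ?_, hTB.trans hBH, fun x hx => ⟨(hR' x hx).1, (hR' x hx).2.2⟩⟩
  intro v hv
  by_contra hvH
  have hvB : v ∉ B := fun h => hvH (hBH h)
  obtain ⟨w, E, C, hw, hvw, hE, hEu⟩ := exists_isEar_of_reflTransGen hR.mem hv hvH (hS v hv)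
  have hZH : Disjoint (H ∪ N)ᶜ H := Set.disjoint_left.2 fun a ha h => ha (.inl h)
  have hZN : Disjoint (H ∪ N)ᶜ N := Set.disjoint_left.2 fun a ha h => ha (.inr h)
  have hTH := hTB.trans hBH
  -- By `noCycle` an ear never ends at a vertex of possible weight three, so weights do not climb
  -- further.
  have hwB : w ∉ N \ B := fun h => noCycle v ⟨hv, hvB⟩ w h hvw _ E C
    (Set.compl_subset_compl.2 (Set.union_subset_union_left _ hBH)) hE
  have hwH : w ∈ H := hw.resolve_right fun h => hwB ⟨h.1, fun h' => h.2 (hBH h')⟩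
  refine hvH (hmaxH _ ⟨hBH.trans Set.subset_union_left, _,
    hR.add_ear hE hZH hvH hwH (hN v hv).1 hEu, ?_⟩ Set.subset_union_left (.inr (.inl rfl)))
  have hRR : ∀ a b, R a b → R a b ∨ E a b ∨ (a = u ∧ b = v) := fun _ _ h => .inl h
  have hER : ∀ a b, E a b → R a b ∨ E a b ∨ (a = u ∧ b = v) := fun _ _ h => .inr (.inl h)
  have hfrom := fun x hx => hE.near_from (R := fun a b => R a b ∨ E a b ∨ (a = u ∧ b = v)) (x := x)
    (T := ∅) hER (.inr (.inr ⟨rfl, rfl⟩)) hZN (Set.disjoint_empty _) huN (fun h => h)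
    (fun h => h) hx
  rintro x (hx | rfl | hx)
  · obtain ⟨h1, h2, h3⟩ := hR' x hx
    exact ⟨h1.imp (fun h => h.mono hRR subset_rfl le_rfl) fun h => h.mono hRR subset_rfl le_rfl,
      fun hx => (h2 hx).imp (fun h => h.mono hRR subset_rfl le_rfl)
        fun h => h.mono hRR subset_rfl le_rfl,
      h3.imp (fun h => h.mono hRR subset_rfl le_rfl) fun h => h.mono hRR subset_rfl le_rfl⟩
  · refine ⟨((hR' w hwH).2.1 hwB).imp (fun h => ?_) (fun h => ?_), fun h => (h ⟨hv, hvB⟩).elim,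
      .inl (hfrom x (.inl rfl))⟩
    · exact hE.near_start hER hRR hZN (Set.disjoint_empty _) (fun h => h) h
    · exact hE.near_start hER hRR hZN (hZH.mono_right hTH) (fun h => hvH (hTH h)) h
  · have h1 := ((hR' w hwH).2.1 hwB).imp
      (fun h => hE.near_inner hER hRR hZN (Set.disjoint_empty _) h hx)
      (fun h => hE.near_inner hER hRR hZN (hZH.mono_right hTH) h hx)
    exact ⟨h1.imp (fun h => h.mono (fun _ _ h => h) subset_rfl (by norm_num))
      fun h => h.mono (fun _ _ h => h) subset_rfl (by norm_num), fun _ => h1,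
      .inl (hfrom x (.inr hx))⟩

/-- If the steps can be reversed, then there is a core containing `N` whose vertices have weight at
most two to and from `u`. -/
theorem exists_isCore_of_symm (symm : ∀ a b, S a b → S b a) :
    ∃ H R, IsCore S u H R ∧ N ⊆ H ∧ ∀ x ∈ H, Near R N ∅ 2 x u ∧ Near R N ∅ 2 u x := by
  -- The invariant asks for weight one in at least one direction, so that a new ear can end where it
  -- is cheap.
  obtain ⟨H, ⟨R, hR, hR'⟩, hmax⟩ := exists_maximal_set (P := fun H => ∃ R, IsCore S u H R ∧
      ∀ x ∈ H, (Near R N ∅ 1 u x ∧ Near R N ∅ 2 x u) ∨ (Near R N ∅ 2 u x ∧ Near R N ∅ 1 x u))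
    ⟨_, IsCore.trivial S u, by
      rintro x rfl
      exact .inl ⟨.self huN (fun h => h), .self huN (fun h => h)⟩⟩
  have lift : ∀ {R' : V → V → Prop}, (∀ a b, R a b → R' a b) → ∀ x ∈ H,
      (Near R' N ∅ 1 u x ∧ Near R' N ∅ 2 x u) ∨ (Near R' N ∅ 2 u x ∧ Near R' N ∅ 1 x u) :=
    fun hRR x hx => (hR' x hx).imp
      (fun h => ⟨h.1.mono hRR subset_rfl le_rfl, h.2.mono hRR subset_rfl le_rfl⟩)
      fun h => ⟨h.1.mono hRR subset_rfl le_rfl, h.2.mono hRR subset_rfl le_rfl⟩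
  refine ⟨H, R, hR, ?_, fun x hx => ?_⟩
  · intro v hv
    by_contra hvH
    obtain ⟨w, E, C, hw, hvw, hE, hEu⟩ := exists_isEar_of_reflTransGen hR.mem hv hvH (hS v hv)
    have hZH : Disjoint (H ∪ N)ᶜ H := Set.disjoint_left.2 fun a ha h => ha (.inl h)
    have hZN : Disjoint (H ∪ N)ᶜ N := Set.disjoint_left.2 fun a ha h => ha (.inr h)
    rcases hw with hw | hw
    · have hRR : ∀ a b, R a b → R a b ∨ E a b ∨ (a = u ∧ b = v) := fun _ _ h => .inl h
      have hER : ∀ a b, E a b → R a b ∨ E a b ∨ (a = u ∧ b = v) := fun _ _ h => .inr (.inl h)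
      have hRR' : ∀ a b, R b a → R b a ∨ E a b ∨ (a = u ∧ b = v) := fun _ _ h => .inl h
      have hER' : ∀ a b, E a b → R b a ∨ E a b ∨ (a = u ∧ b = v) := fun _ _ h => .inr (.inl h)
      -- If `w` is cheap from `u`, the ear is reversed and leads from `w` to `v` and on to `u`;
      -- otherwise it is used as it stands.
      rcases hR' w hw with ⟨h1, -⟩ | ⟨-, h1⟩
      · have hc := (hR.swap.add_ear (hE.mono (fun a b h => symm _ _ h) subset_rfl) hZH hvH hw
          (hN v hv).2 hEu).swap
        refine hvH (hmax _ ⟨_, hc, ?_⟩ Set.subset_union_left (.inr (.inl rfl)))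
        have hto := fun x hx => (hE.near_from
          (R := fun a b => R b a ∨ E a b ∨ (a = u ∧ b = v)) (x := x) (T := ∅) hER'
          (.inr (.inr ⟨rfl, rfl⟩)) hZN (Set.disjoint_empty _) huN (fun h => h) (fun h => h) hx).swap
        rintro x (hx | rfl | hx)
        · exact lift (fun a b h => .inl h) x hx
        · exact .inr ⟨(hE.near_start hER' hRR' hZN (Set.disjoint_empty _) (fun h => h) h1.swap).swap,
            hto x (.inl rfl)⟩
        · exact .inr ⟨(hE.near_inner hER' hRR' hZN (Set.disjoint_empty _) h1.swap hx).swap.mono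
            (fun _ _ h => h) subset_rfl (by norm_num), hto x (.inr hx)⟩
      · have hc := hR.add_ear hE hZH hvH hw (hN v hv).1 hEu
        refine hvH (hmax _ ⟨_, hc, ?_⟩ Set.subset_union_left (.inr (.inl rfl)))
        have hfrom := fun x hx => hE.near_from
          (R := fun a b => R a b ∨ E a b ∨ (a = u ∧ b = v)) (x := x) (T := ∅) hER
          (.inr (.inr ⟨rfl, rfl⟩)) hZN (Set.disjoint_empty _) huN (fun h => h) (fun h => h) hx
        rintro x (hx | rfl | hx)
        · exact lift hRR x hx
        · exact .inl ⟨hfrom x (.inl rfl),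
            hE.near_start hER hRR hZN (Set.disjoint_empty _) (fun h => h) h1⟩
        · exact .inl ⟨hfrom x (.inr hx), (hE.near_inner hER hRR hZN (Set.disjoint_empty _) h1
            hx).mono (fun _ _ h => h) subset_rfl (by norm_num)⟩
    · refine hvH (hmax _ ⟨_, hR.add_cycle hE hZH hvH hw.2 hvw (hN v hv).1 (hN w hw.1).2, ?_⟩
        Set.subset_union_left (.inr (.inl rfl)))
      rintro x (hx | hx)
      · exact lift (fun a b h => .inl h) x hx
      · exact hE.near_cycle (fun _ _ h => .inr (.inl h)) (.inr (.inr (.inl ⟨rfl, rfl⟩)))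
          (.inr (.inr (.inr ⟨rfl, rfl⟩))) hZN (Set.disjoint_empty _) huN (fun h => h)
          (fun h => h) (fun h => h) hx
  · rcases hR' x hx with h | h
    · exact ⟨h.2, h.1.mono (fun _ _ h => h) subset_rfl (by norm_num)⟩
    · exact ⟨h.2.mono (fun _ _ h => h) subset_rfl (by norm_num), h.1⟩

omit hS in
/-- A closed walk through `u` starting with the step `ut`, where `t ∉ N`. -/
theorem exists_isCore_of_arc {t : V} (hut : S u t) (htu : ¬ S t u) (hne : t ≠ u) (htN : t ∉ N)
    (h : ReflTransGen S t u) :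
    ∃ H R, IsCore S u H R ∧ t ∈ H ∧ ∀ x ∈ H, Near R N ∅ 1 x u ∧ Near R N ∅ 1 u x := by
  obtain ⟨w, hw, p⟩ := InnerWalk.of_reflTransGen (A := insert u N) h
    (fun h => h.elim hne htN) (.inl rfl)
  have htw : t ≠ w := by
    rintro rfl
    exact hw.elim hne htN
  obtain ⟨E, C, hE⟩ := InnerWalk.exists_isEar _ rfl p (by simp) (fun h => h.1 hw) htw
  have hZN : Disjoint ((insert u N)ᶜ \ {t}) N := Set.disjoint_left.2 fun a ha h => ha.1 (.inr h)
  have hZu : Disjoint ((insert u N)ᶜ \ {t}) {u} := Set.disjoint_left.2 fun a ha h => ha.1 (.inl h)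
  have h0 := IsCore.trivial S u
  rcases hw with rfl | hw
  · have hc := h0.add_ear hE hZu hne rfl hut fun h => htu (hE.le _ _ h)
    refine ⟨_, _, hc, .inr (.inl rfl), ?_⟩
    have hself : Near (fun a b => False ∨ E a b ∨ (a = w ∧ b = t)) N ∅ 0 w w :=
      .self huN (fun h => h)
    have hfrom := fun x hx => hE.near_from
      (R := fun a b => False ∨ E a b ∨ (a = w ∧ b = t)) (x := x) (T := ∅)
      (fun _ _ h => .inr (.inl h)) (.inr (.inr ⟨rfl, rfl⟩)) hZN (Set.disjoint_empty _) huN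
      (fun h => h) (fun h => h) hx
    rintro x (rfl | rfl | hx)
    · exact ⟨.self huN (fun h => h), .self huN (fun h => h)⟩
    · exact ⟨hE.near_start (fun _ _ h => .inr (.inl h)) (fun _ _ h => h) hZN
        (Set.disjoint_empty _) (fun h => h) hself, hfrom x (.inl rfl)⟩
    · exact ⟨(hE.near_inner (fun _ _ h => .inr (.inl h)) (fun _ _ h => h) hZN
        (Set.disjoint_empty _) hself hx).mono (fun _ _ h => h) subset_rfl (by norm_num),
        hfrom x (.inr hx)⟩
  · have hwu : w ∉ ({u} : Set V) := fun h => huN (h ▸ hw)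
    have hc := h0.add_cycle hE hZu hne hwu htw hut (hN w hw).2
    refine ⟨_, _, hc, .inr (.inl rfl), ?_⟩
    -- The walk stops at its first vertex in `N`, so the whole closed walk meets `N` only in `w`.
    have hNw : insert u (insert t (insert w C)) ∩ N ⊆ {w} := by
      rintro a ⟨rfl | rfl | rfl | ha, haN⟩
      exacts [(huN haN).elim, (htN haN).elim, rfl,
        (Set.disjoint_left.1 hZN (hE.inner ha) haN).elim]
    have hER : ∀ a b, E a b → False ∨ E a b ∨ (a = u ∧ b = t) ∨ (a = w ∧ b = u) :=
      fun _ _ h => .inr (.inl h)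
    have hfrom := fun x hx => hE.near_from
      (R := fun a b => False ∨ E a b ∨ (a = u ∧ b = t) ∨ (a = w ∧ b = u)) (x := x) (T := ∅)
      hER (.inr (.inr (.inl ⟨rfl, rfl⟩))) hZN (Set.disjoint_empty _) huN
      (fun h => h) (fun h => h) hx
    have hto := fun x hx => hE.near_to
      (R := fun a b => False ∨ E a b ∨ (a = u ∧ b = t) ∨ (a = w ∧ b = u)) (x := x) (T := ∅)
      hER (.inr (.inr (.inr ⟨rfl, rfl⟩))) hZN (Set.disjoint_empty _) huN
      (fun h => h) (fun h => h) hx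
    rintro x (rfl | rfl | rfl | hx)
    · exact ⟨.self huN (fun h => h), .self huN (fun h => h)⟩
    · exact ⟨.of_linked (hE.linked_to_start hER (.inr (.inr (.inr ⟨rfl, rfl⟩))))
        (Set.disjoint_empty _) hNw, hfrom x (.inl rfl)⟩
    · exact ⟨hto x (.inl rfl), .of_linked (hE.linked_from_end hER
        (.inr (.inr (.inl ⟨rfl, rfl⟩)))) (Set.disjoint_empty _) hNw⟩
    · exact ⟨hto x (.inr hx), hfrom x (.inr hx)⟩

end Stages

/-! ### From cores to the oriented diameter. -/

namespace MixedGraph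

variable {V : Type*} {G : MixedGraph V} {u : V} {N T : Set V}

theorem orientedDiam_le {D : MixedGraph V} {m : ℕ} (h : G.IsStrongOrientation D)
    (h' : ∀ x y, D.dist x y ≤ m) : G.orientedDiam ≤ m :=
  (iInf₂_le D h).trans (iSup₂_le h')

theorem exists_arc_of_degree_pos (h : 1 ≤ G.outDegree u + G.inDegree u) :
    ∃ t, G.Arc u t ∨ G.Arc t u := by
  by_contra! hcon
  have h1 : G.outDegree u = 0 := by simp [outDegree, fun y => (hcon y).1]
  have h2 : G.inDegree u = 0 := by simp [inDegree, fun y => (hcon y).2]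
  omega

variable [Fintype V]

/-- The walks joined at `u` use at most `k + l` vertices of `N`, and all their other vertices lie
outside `N ∪ T`. -/
theorem dist_le_of_near {D : MixedGraph V} {k l m : ℕ} {x y : V} (h : Near D.Step N T k x u)
    (h' : Near D.Step N T l u y) (hm : k + l + ((N ∪ T)ᶜ : Set V).ncard ≤ m + 1) :
    D.dist x y ≤ m := by
  obtain ⟨W, h1, h2, h3⟩ := h
  obtain ⟨W', h1', h2', h3'⟩ := h'
  obtain ⟨j, hj, hp⟩ := hasPath_of_linked ((h3.mono (fun _ _ h => h) Set.subset_union_left).trans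
    (h3'.mono (fun _ _ h => h) (Set.subset_union_right (s := W))))
  have hsub : W ∪ W' ⊆ ((W ∩ N) ∪ (W' ∩ N)) ∪ (N ∪ T)ᶜ := by
    intro a ha
    by_cases haN : a ∈ N
    · exact .inl (ha.imp (fun h => ⟨h, haN⟩) fun h => ⟨h, haN⟩)
    · refine .inr fun h => ?_
      rcases ha with ha | ha
      · exact h.elim haN (Set.disjoint_left.1 h2 ha)
      · exact h.elim haN (Set.disjoint_left.1 h2' ha)
  have c1 := Set.ncard_le_ncard hsub
  have c2 := Set.ncard_union_le ((W ∩ N) ∪ (W' ∩ N)) (N ∪ T)ᶜ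
  have c3 := Set.ncard_union_le (W ∩ N) (W' ∩ N)
  refine (iInf₂_le j hp).trans ?_
  exact_mod_cast (by omega : j ≤ m)

/-- The bounds on the weights in a core containing `N` carry over to the vertices outside it. -/
theorem Bridgeless.exists_isStrongOrientation_near (hG : G.Bridgeless) {H : Set V}
    {R : V → V → Prop} (hR : IsCore G.Step u H R) (hN : N ⊆ H) (hT : T ⊆ H) {k k' l l' : ℕ}
    (h : ∀ x ∈ H, (Near R N ∅ k x u ∨ Near R N T k' x u) ∧
      (Near R N ∅ l u x ∨ Near R N T l' u x)) :
    ∃ D, G.IsStrongOrientation D ∧ ∀ x,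
      (Near D.Step N ∅ k x u ∨ Near D.Step N T k' x u) ∧
      (Near D.Step N ∅ l u x ∨ Near D.Step N T l' u x) := by
  obtain ⟨D, hD, hRD⟩ := hG.exists_isStrongOrientation hR.asymm hR.le (by
    intro a b hab
    exact ((h b (hR.target _ _ hab)).1.elim Near.reflTransGen Near.reflTransGen).trans
      ((h a (hR.source _ _ hab)).2.elim Near.reflTransGen Near.reflTransGen))
  have hRS : ∀ a b, R a b → D.Step a b := fun a b hab => .inr (hRD a b hab)
  have hconn := connected_iff.1 hD.2.2
  refine ⟨D, hD, fun x => ⟨?_, ?_⟩⟩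
  -- Vertices outside `H` are in neither `N` nor `T`, so following `D` until it enters `H` is free.
  · induction hconn x u using ReflTransGen.head_induction_on with
    | refl =>
      exact (h u hR.mem).1.imp (·.mono hRS subset_rfl le_rfl) (·.mono hRS subset_rfl le_rfl)
    | @head a b hab _ ih =>
      by_cases ha : a ∈ H
      · exact (h a ha).1.imp (·.mono hRS subset_rfl le_rfl) (·.mono hRS subset_rfl le_rfl)
      have hl : Linked D.Step {a, b} a b := .single hab (by simp) (by simp)
      refine ih.imp (fun h => h.prepend hl (fun _ _ h => h) ?_ ?_)
        fun h => h.prepend hl (fun _ _ h => h) ?_ ?_ <;>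
      rintro c (rfl | rfl) hc hc'
      exacts [hc', hc rfl, ha (hN hc'), hc rfl, ha (hT hc'), hc rfl, ha (hN hc'), hc rfl]
  · induction hconn u x with
    | refl =>
      exact (h u hR.mem).2.imp (·.mono hRS subset_rfl le_rfl) (·.mono hRS subset_rfl le_rfl)
    | @tail b a _ hba ih =>
      by_cases ha : a ∈ H
      · exact (h a ha).2.imp (·.mono hRS subset_rfl le_rfl) (·.mono hRS subset_rfl le_rfl)
      have hl : Linked (Function.swap D.Step) {a, b} a b := .single hba (by simp) (by simp)
      refine ih.imp (fun h => (h.swap.prepend hl (fun _ _ h => h) ?_ ?_).swap)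
        fun h => (h.swap.prepend hl (fun _ _ h => h) ?_ ?_).swap <;>
      rintro c (rfl | rfl) hc hc'
      exacts [hc', hc rfl, ha (hN hc'), hc rfl, ha (hT hc'), hc rfl, ha (hN hc'), hc rfl]

theorem Bridgeless.reflTransGen_avoiding (hG : G.Bridgeless) {v : V} (hv : G.Edge u v) :
    ReflTransGen (fun a b => G.Step a b ∧ ¬ (a = v ∧ b = u)) v u := by
  refine ReflTransGen.mono ?_ _ _ (hG.reflTransGen hv v u)
  rintro a b (h | h)
  · refine ⟨.inl h.1, ?_⟩
    rintro ⟨rfl, rfl⟩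
    exact h.2 Sym2.eq_swap
  · refine ⟨.inr h, ?_⟩
    rintro ⟨rfl, rfl⟩
    exact G.not_arc_of_edge _ _ (G.edge_symm _ _ hv) h

theorem ncard_compl_edge (G : MixedGraph V) (u : V) :
    ({y | G.Edge u y}ᶜ : Set V).ncard = Fintype.card V - G.undirDegree u := by
  rw [Set.ncard_compl, Nat.card_eq_fintype_card]
  rfl

theorem Bridgeless.orientedDiam_le_add_four (hG : G.Bridgeless) (u : V) :
    G.orientedDiam ≤ ((Fintype.card V - G.undirDegree u + 4 : ℕ) : ℕ∞) := by
  have hu : u ∉ {y | G.Edge u y} := G.edge_irrefl u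
  obtain ⟨H, R, hR, hN, hT, hH⟩ := (IsCore.trivial G.Step u).exists_extension hu
    (fun v hv => ⟨.inl hv, .inl (G.edge_symm _ _ hv)⟩) (fun v hv => hG.reflTransGen_avoiding hv)
    (Set.empty_subset _) (fun h => h) (by
      rintro x rfl
      exact ⟨.self hu (fun h => h), .self hu (fun h => h)⟩)
  obtain ⟨D, hD, hDn⟩ := hG.exists_isStrongOrientation_near hR hN hT hH
  refine orientedDiam_le hD fun x y => ?_
  have h1 : Near D.Step {y | G.Edge u y} ∅ 3 x u :=
    (hDn x).1.elim (fun h => h.mono (fun _ _ h => h) subset_rfl (by norm_num)) id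
  have h2 : Near D.Step {y | G.Edge u y} ∅ 2 u y :=
    (hDn y).2.elim (fun h => h.mono (fun _ _ h => h) subset_rfl (by norm_num)) id
  refine dist_le_of_near h1 h2 ?_
  rw [Set.union_empty, ncard_compl_edge]
  omega

theorem Bridgeless.orientedDiam_le_of_isUndirected (hG : G.Bridgeless) (hund : G.IsUndirected)
    (u : V) : G.orientedDiam ≤ ((Fintype.card V - G.undirDegree u + 3 : ℕ) : ℕ∞) := by
  have hu : u ∉ {y | G.Edge u y} := G.edge_irrefl u
  obtain ⟨H, R, hR, hN, hH⟩ := exists_isCore_of_symm (S := G.Step) hu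
    (fun v hv => ⟨.inl hv, .inl (G.edge_symm _ _ hv)⟩) (fun v hv => hG.reflTransGen_avoiding hv)
    (fun a b h => .inl (G.edge_symm _ _ (h.resolve_right (hund a b))))
  obtain ⟨D, hD, hDn⟩ := hG.exists_isStrongOrientation_near (T := ∅) hR hN (Set.empty_subset _)
    (k' := 2) (l' := 2) fun x hx => ⟨.inl (hH x hx).1, .inl (hH x hx).2⟩
  refine orientedDiam_le hD fun x y => dist_le_of_near ((hDn x).1.elim id id)
    ((hDn y).2.elim id id) ?_
  rw [Set.union_empty, ncard_compl_edge]
  omega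

/-- A directed edge at `u` improves the bound by one. -/
theorem Bridgeless.orientedDiam_le_of_arc (hG : G.Bridgeless) {u t : V}
    (hut : G.Arc u t ∨ G.Arc t u) :
    G.orientedDiam ≤ ((Fintype.card V - G.undirDegree u + 3 : ℕ) : ℕ∞) := by
  have hu : u ∉ {y | G.Edge u y} := G.edge_irrefl u
  have hstep : ∀ v ∈ {y | G.Edge u y}, G.Step u v ∧ G.Step v u :=
    fun v hv => ⟨.inl hv, .inl (G.edge_symm _ _ hv)⟩
  have htN : t ∉ {y | G.Edge u y} := fun h => hut.elim (G.not_arc_of_edge _ _ h)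
    (G.not_arc_of_edge _ _ (G.edge_symm _ _ h))
  have hne : t ≠ u := by
    rintro rfl
    exact hut.elim (G.arc_irrefl _) (G.arc_irrefl _)
  obtain ⟨H₀, R₀, h₀, htH, hH₀⟩ : ∃ H R, IsCore G.Step u H R ∧ t ∈ H ∧ ∀ x ∈ H,
      Near R {y | G.Edge u y} ∅ 1 x u ∧ Near R {y | G.Edge u y} ∅ 1 u x := by
    have hconn := connected_iff.1 hG.1
    rcases hut with hut | htu
    · exact exists_isCore_of_arc hu hstep (.inr hut) (not_step_of_arc hut) hne htN (hconn t u)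
    -- An arc entering `u` is treated by reversing all steps.
    · obtain ⟨H, R, h1, h2, h3⟩ := exists_isCore_of_arc (S := Function.swap G.Step) hu
        (fun v hv => (hstep v hv).symm) (.inr htu) (not_step_of_arc htu) hne htN
        ((hconn u t).swap)
      exact ⟨H, _, h1.swap, h2, fun x hx => ⟨(h3 x hx).2.swap, (h3 x hx).1.swap⟩⟩
  obtain ⟨H, R, hR, hN, hT, hH⟩ := h₀.exists_extension hu hstep
    (fun v hv => hG.reflTransGen_avoiding hv) (T := {t}) (by simpa using htH)
    (fun h => hne h.symm) hH₀
  obtain ⟨D, hD, hDn⟩ := hG.exists_isStrongOrientation_near hR hN hT hH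
  refine orientedDiam_le hD fun x y => ?_
  have c1 := ncard_compl_edge G u
  have c2 : ({y | G.Edge u y} ∪ {t} : Set V)ᶜ.ncard + 1 = ({y | G.Edge u y}ᶜ : Set V).ncard := by
    rw [Set.compl_union, ← Set.sdiff_eq]
    exact Set.ncard_sdiff_singleton_add_one htN
  -- The weights sum to at most four, except for `3 + 2`; there both walks avoid `t`, which saves
  -- one vertex outside `N`.
  rcases (hDn x).1 with h1 | h1 <;> rcases (hDn y).2 with h2 | h2
  · refine dist_le_of_near h1 h2 ?_
    rw [Set.union_empty]
    omega
  · refine dist_le_of_near h1 (h2.mono (fun _ _ h => h) (Set.empty_subset _) le_rfl) ?_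
    rw [Set.union_empty]
    omega
  · refine dist_le_of_near (h1.mono (fun _ _ h => h) (Set.empty_subset _) le_rfl) h2 ?_
    rw [Set.union_empty]
    omega
  · exact dist_le_of_near h1 h2 (by omega)

theorem exists_undirDegree_eq [Nonempty V] (G : MixedGraph V) :
    ∃ u, G.undirDegree u = G.maxUndirDegree := by
  obtain ⟨u, _, hu⟩ := Finset.exists_mem_eq_sup Finset.univ Finset.univ_nonempty G.undirDegree
  exact ⟨u, hu.symm⟩

end MixedGraph

theorem corollary1p4 {V : Type*} [Fintype V] [Nonempty V] (G : MixedGraph V)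
    (n Δ : ℕ) (hn : Fintype.card V = n) (hΔ : G.maxUndirDegree = Δ) (hG : G.Bridgeless) :
    ((G.IsUndirected ∨
        (∃ u, G.undirDegree u = Δ ∧ 2 ≤ G.outDegree u + G.inDegree u) ∨
        (∃ u, G.undirDegree u = Δ ∧ Δ = 5 ∧ G.outDegree u + G.inDegree u = 1)) →
      G.orientedDiam ≤ ((n - Δ + 3 : ℕ) : ℕ∞)) ∧
    (¬ (G.IsUndirected ∨
        (∃ u, G.undirDegree u = Δ ∧ 2 ≤ G.outDegree u + G.inDegree u) ∨
        (∃ u, G.undirDegree u = Δ ∧ Δ = 5 ∧ G.outDegree u + G.inDegree u = 1)) →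
      G.orientedDiam ≤ ((n - Δ + 4 : ℕ) : ℕ∞)) := by
  obtain ⟨v, hv⟩ := G.exists_undirDegree_eq
  rw [hΔ] at hv
  -- Both degree conditions provide an arc at a vertex of maximum undirected degree.
  have harc : ∀ u, G.undirDegree u = Δ → 1 ≤ G.outDegree u + G.inDegree u →
      G.orientedDiam ≤ ((n - Δ + 3 : ℕ) : ℕ∞) := by
    intro u hu h
    obtain ⟨t, ht⟩ := MixedGraph.exists_arc_of_degree_pos h
    simpa only [hn, hu] using hG.orientedDiam_le_of_arc ht
  refine ⟨?_, fun _ => by simpa only [hn, hv] using hG.orientedDiam_le_add_four v⟩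
  rintro (h | ⟨u, hu, h⟩ | ⟨u, hu, _, h⟩)
  · simpa only [hn, hv] using hG.orientedDiam_le_of_isUndirected h v
  · exact harc u hu (by omega)
  · exact harc u hu h.ge
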